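/- Let $[n]=\{1,\dots,n\}$; all families consist of $k$-element subsets ($k$-sets) of $[n]$. A family $\mathcal F$ is intersecting if any two members meet, and it is $(s,t)$-union intersecting if $\left(\bigcup_{i=1}^{s}A_i\right)\cap\left(\bigcup_{i=1}^{t}A_{s+i}\right)\neq\varnothing$ for any $s+t$ distinct members $A_1,\dots,A_{s+t}$ of $\mathcal F$. Let $\ell(\mathcal F)$ be the minimum number of members whose removal from $\mathcal F$ leaves an intersecting family. Two families are isomorphic if a permutation of $[n]$ carries one to the other. Let $\mathrm{St}_1$ be the family of all $k$-sets containing $1$. For an integer $b\ge 0$ and distinct $k$-sets $A_1,\dots,A_{s+b}$ not containing $1$, let $\mathrm{St}_1(A_1,\dots,A_{s+b}:s)$ be the family of all $A\in\mathrm{St}_1$ that are disjoint from at most $s-1$ of the $A_i$, and let $T(A_1,\dots,A_{s+b}:s)$ be the set of all $x\in[n]$ that belong to $A_i$ for at least $b+1$ indices $i$. For integers $k,s,\beta$ put $m_\beta=\left\lfloor\frac{(s+\beta)k}{\beta+1}\right\rfloor$. If $m_\beta>k$, let $\hat\beta$ be the largest integer $b\ge 0$ with $m_b=m_\beta$; if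 $m_\beta=k$, let $\hat\beta=\beta$. Theorem. Let $k\ge 3$, $t\ge s\ge 1$ and $\beta\ge 0$ be integers. There is an $N=N(s,t,k,\beta)$ such that for all $n\ge N$ the following holds. Let $\mathcal F$ be an $(s,t)$-union intersecting family of $k$-sets of $[n]$ with $\ell(\mathcal F)\ge s+\beta$. Then $$|\mathcal F|\le\binom{n-1}{k-1}-\binom{n-\left\lfloor\frac{(s+\beta)k}{\beta+1}\right\rfloor-1}{k-1}+s+t+\hat\beta-1 .$$ Equality holds if and only if there exist pairwise distinct $k$-sets $A_1,\dots,A_{s+\hat\beta},F_1,\dots,F_{t-1}$ of $[n]$ such that 1. $1\notin\bigcup_{i=1}^{s+\hat\beta}A_i$; 2. $|T(A_1,\dots,A_{s+\hat\beta}:s)|=\left\lfloor\frac{(s+\beta)k}{\beta+1}\right\rfloor$; 3. $F_i\in\mathrm{St}_1\setminus\mathrm{St}_1(A_1,\dots,A_{s+\hat\beta}:s)$ for each $i\le t-1$; 4. the family $\{A_1,\dots,A_{s+\hat\beta},F_1,\dots,F_{t-1}\}$ is $(s,t)$-union intersecting; and $\mathcal F$ is isomorphic to $\mathrm{St}_1(A_1,\dots,A_{s+\hat\beta}:s)\cup\{A_1,\dots,A_{s+\hat\beta}\}\cup\{F_1,\dots,F_{t-1}\}$.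 -/

import Mathlib

namespace UnionIntersecting

/-- A finite family `F` is `(s,t)`-union intersecting: whenever `s + t` distinct members of `F` are
split into a part `P` with `s` members and a part `Q` with `t` members, the union of the members of
`P` meets the union of the members of `Q`. -/
def IsUnionIntersecting {α : Type*} [DecidableEq α] (s t : ℕ) (F : Finset (Finset α)) : Prop :=
  ∀ P Q : Finset (Finset α), P ⊆ F → Q ⊆ F → Disjoint P Q → P.card = s → Q.card = t →
    (P.biUnion id ∩ Q.biUnion id).Nonempty

/-- The minimum number of members that have to be removed from `F` to leave an intersecting
family. -/
noncomputable def ell {α : Type*} [DecidableEq α] (F : Finset (Finset α)) : ℕ :=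
  sInf {m : ℕ | ∃ R : Finset (Finset α), R ⊆ F ∧ R.card = m ∧
    ((F \ R : Finset (Finset α)) : Set (Finset α)).Intersecting}

/-- The full star with centre `x`: all `k`-subsets of the ground set `Fin n` that contain `x`. -/
def star {n : ℕ} (k : ℕ) (x : Fin n) : Finset (Finset (Fin n)) :=
  ((Finset.univ : Finset (Fin n)).powersetCard k).filter (fun B => x ∈ B)

/-- The members of the star with centre `x` that are disjoint from at most `s - 1`
of the sets `A i`. -/
def starMeeting {n : ℕ} (k s b : ℕ) (x : Fin n) (A : Fin (s + b) → Finset (Fin n)) :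
    Finset (Finset (Fin n)) :=
  (star k x).filter
    (fun B => ((Finset.univ : Finset (Fin (s + b))).filter (fun i => Disjoint B (A i))).card
      ≤ s - 1)

/-- The elements lying in `A i` for at least `b + 1` distinct indices `i`, where `A` is a list of
`s + b` sets. -/
def manyFold {n : ℕ} (s b : ℕ) (A : Fin (s + b) → Finset (Fin n)) : Finset (Fin n) :=
  Finset.univ.filter
    (fun x => ∃ I : Finset (Fin (s + b)), I.card = b + 1 ∧ ∀ i ∈ I, x ∈ A i)

/-- The integer part of `(s + b) k / (b + 1)`. -/
def threshold (k s b : ℕ) : ℕ := (s + b) * k / (b + 1)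

/-- If `threshold k s b > k`, the largest `c` with `threshold k s c = threshold k s b`
(the set of such `c` is then finite and contains `b`); otherwise `b` itself. -/
noncomputable def betaHat (k s b : ℕ) : ℕ :=
  if k < threshold k s b then sSup {c : ℕ | threshold k s c = threshold k s b} else b

/-- Two families on the ground set are isomorphic: a permutation of the ground set carries one to
the other. -/
def Isomorphic {α : Type*} [DecidableEq α] (F G : Finset (Finset α)) : Prop :=
  ∃ σ : Equiv.Perm α, F = G.image (fun B => B.map σ.toEmbedding)

end UnionIntersecting

/-! Call a set robust if no few points outside it meet all members containing it. A robust set of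
size below $k$ misses fewer than $s$ members: otherwise $t$ members through it could avoid the union
of $s$ members missing it. Hence robust sets pairwise meet, and $\ell\ge s$ forces size at least 2.

Boundedly many robust sets or $k$-sets cover $\mathcal F$ (`exists_robust_cover`). A cover set of
size at least 3 accounts for only $O(n^{k-3})$ members, so a family as large as the main term needs
at least $m=m_\beta$ robust pairs. Being pairwise intersecting, these share a centre $x$ or form a
triangle, and $\ell\ge s+\beta$ excludes the triangle. Let $Y$ be the set of other ends.

If $s+b$ members avoid $x$, each $y\in Y$ lies in at least $b+1$ of them. Counting incidences gives
$|Y|\le m_b\le m_\beta$, so equality holds throughout and $b\le\hat\beta$. Fewer than $b+1$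
incidences fall outside $Y$, so any set avoiding $Y$ misses at least $s$ of these members; thus at
most $t-1$ members through $x$ avoid $Y$. Adding the members through $x$ that meet $Y$ gives the
bound, and equality makes every estimate tight. -/

namespace UnionIntersecting

/-! ### Robust sets and their intersection properties -/

section Robust

variable {α : Type*} [DecidableEq α] {F : Finset (Finset α)} {k s t M : ℕ} {X : Finset α}

/-- `X` is robust in `F` if no set of at most `M` elements outside `X` meets all the members of `F`
that contain `X`. -/
def Robust (F : Finset (Finset α)) (M : ℕ) (X : Finset α) : Prop :=
  ∀ Z : Finset α, Z.card ≤ M → Disjoint X Z → ∃ B ∈ F, X ⊆ B ∧ Disjoint B Z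

theorem card_biUnion_id_le {P : Finset (Finset α)} (h : ∀ B ∈ P, B.card = k) :
    (P.biUnion id).card ≤ P.card * k :=
  Finset.card_biUnion_le_card_mul _ _ _ fun B hB => (h B hB).le

/-- Greedy choice: each new member must also avoid the points outside `X` of the earlier ones. Since
`X.card < k` it has a point outside `X`, so it is new. -/
theorem Robust.exists_members (hX : Robust F M X) (hF : ∀ B ∈ F, B.card = k) (hXk : X.card < k)
    {Z : Finset α} (hZ : Disjoint X Z) (j : ℕ) (hM : Z.card + j * k ≤ M) :
    ∃ P ⊆ F, P.card = j ∧ ∀ B ∈ P, X ⊆ B ∧ Disjoint B Z := by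
  induction j with
  | zero => exact ⟨∅, by simp⟩
  | succ j ih =>
    obtain ⟨P, hPF, hPj, hP⟩ := ih (by rw [Nat.succ_mul] at hM; omega)
    have hc := card_biUnion_id_le fun B hB => hF B (hPF hB)
    obtain ⟨B, hBF, hXB, hBZ⟩ := hX (Z ∪ (P.biUnion id \ X))
      (by
        have h1 := Finset.card_union_le Z (P.biUnion id \ X)
        have h2 := Finset.card_le_card (Finset.sdiff_subset (s := P.biUnion id) (t := X))
        rw [hPj] at hc
        rw [Nat.succ_mul] at hM
        omega)
      (Finset.disjoint_union_right.2 ⟨hZ, Finset.disjoint_sdiff⟩)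
    rw [Finset.disjoint_union_right] at hBZ
    have hBP : B ∉ P := by
      intro hBP
      obtain ⟨y, hyB, hyX⟩ := Finset.exists_mem_notMem_of_card_lt_card
        (show X.card < B.card by rw [hF B hBF]; exact hXk)
      exact Finset.disjoint_left.1 hBZ.2 hyB
        (Finset.mem_sdiff.2 ⟨Finset.mem_biUnion.2 ⟨B, hBP, hyB⟩, hyX⟩)
    refine ⟨insert B P, Finset.insert_subset hBF hPF, by
      rw [Finset.card_insert_of_notMem hBP, hPj], ?_⟩
    intro C hC
    rcases Finset.mem_insert.1 hC with rfl | hC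
    · exact ⟨hXB, hBZ.1⟩
    · exact hP C hC

theorem Robust.card_filter_disjoint_lt (hX : Robust F M X) (hF : ∀ B ∈ F, B.card = k)
    (hUI : IsUnionIntersecting s t F) (hXk : X.card < k) (hM : (s + t) * k ≤ M) :
    (F.filter fun B => Disjoint X B).card < s := by
  by_contra! h
  obtain ⟨P, hP, hPs⟩ := Finset.exists_subset_card_eq h
  have hPF : P ⊆ F := fun B hB => (Finset.mem_filter.1 (hP hB)).1
  have hc := card_biUnion_id_le fun B hB => hF B (hPF hB)
  obtain ⟨Q, hQF, hQt, hQ⟩ := hX.exists_members hF hXk (Z := P.biUnion id)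
    ((Finset.disjoint_biUnion_right _ _ _).2 fun B hB => (Finset.mem_filter.1 (hP hB)).2) t
    (by rw [hPs] at hc; rw [add_mul] at hM; omega)
  have hPQ : Disjoint P Q := by
    refine Finset.disjoint_left.2 fun B hBP hBQ => ?_
    have h0 : B = ∅ := Finset.disjoint_self_iff_empty _ |>.1
      ((hQ B hBQ).2.mono_right (Finset.subset_biUnion_of_mem id hBP))
    have := hF B (hPF hBP)
    rw [h0, Finset.card_empty] at this
    omega
  obtain ⟨x, hx⟩ := hUI P Q hPF hQF hPQ hPs hQt
  obtain ⟨hxP, hxQ⟩ := Finset.mem_inter.1 hx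
  obtain ⟨B, hB, hxB⟩ := Finset.mem_biUnion.1 hxQ
  exact Finset.disjoint_left.1 (hQ B hB).2 hxB hxP

theorem Robust.not_disjoint {Y : Finset α} (hX : Robust F M X) (hY : Robust F M Y)
    (hF : ∀ B ∈ F, B.card = k) (hUI : IsUnionIntersecting s t F) (hXk : X.card < k)
    (hYk : Y.card < k) (hM : (s + t + 1) * k ≤ M) : ¬ Disjoint X Y := by
  intro hXY
  have e : (s + t + 1) * k = s * k + t * k + k := by ring
  have e' : (s + t) * k = s * k + t * k := by ring
  obtain ⟨P, hPF, hPs, hP⟩ := hX.exists_members hF hXk hXY s (by omega)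
  have := hY.card_filter_disjoint_lt hF hUI hYk (by omega)
  have h2 : P ⊆ F.filter fun B => Disjoint Y B := fun B hB =>
    Finset.mem_filter.2 ⟨hPF hB, (hP B hB).2.symm⟩
  have := Finset.card_le_card h2
  omega

theorem ell_le {R : Finset (Finset α)} (hR : R ⊆ F)
    (h : ((F \ R : Finset (Finset α)) : Set (Finset α)).Intersecting) : ell F ≤ R.card :=
  Nat.sInf_le ⟨R, hR, rfl, h⟩

theorem ell_le_card_notMem (F : Finset (Finset α)) (x : α) :
    ell F ≤ (F.filter fun B => x ∉ B).card := by
  refine ell_le (Finset.filter_subset _ _) ?_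
  intro B hB C hC
  simp only [Finset.coe_sdiff, Finset.coe_filter, Set.mem_sdiff, Finset.mem_coe, Set.mem_ofPred_eq,
    not_and, not_not] at hB hC
  exact Finset.not_disjoint_iff.2 ⟨x, hB.2 hB.1, hC.2 hC.1⟩

/-- The members missing $\emptyset$ are all of `F`, and deleting the members missing $\{x\}$ leaves
a star; either way fewer than `s` deletions would suffice. -/
theorem Robust.two_le_card (hX : Robust F M X) (hF : ∀ B ∈ F, B.card = k)
    (hUI : IsUnionIntersecting s t F) (hk : 2 ≤ k) (hM : (s + t) * k ≤ M) (hl : s ≤ ell F) :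
    2 ≤ X.card := by
  by_contra! h
  have hlt := hX.card_filter_disjoint_lt hF hUI (by omega) hM
  rcases Nat.lt_succ_iff.1 h |>.lt_or_eq with h0 | h1
  · obtain rfl : X = ∅ := Finset.card_eq_zero.1 (by omega)
    have := ell_le (F := F) (Finset.Subset.refl F) (by simp [Set.Intersecting])
    simp only [Finset.disjoint_empty_left, Finset.filter_true] at hlt
    omega
  · obtain ⟨x, rfl⟩ := Finset.card_eq_one.1 h1
    have := ell_le_card_notMem F x
    simp only [Finset.disjoint_singleton_left] at hlt
    omega

/-- Every member of a `k`-uniform family contains one of boundedly many sets that are robust or of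
size `k`. -/
theorem exists_robust_cover (F : Finset (Finset α)) (hM : 1 ≤ M)
    (j : ℕ) (X : Finset α) (hX : X.card + j = k) :
    ∃ C : Finset (Finset α), C.card ≤ M ^ j ∧ (∀ B ∈ F, X ⊆ B → ∃ L ∈ C, L ⊆ B) ∧
      ∀ L ∈ C, L.card = k ∨ L.card < k ∧ Robust F M L := by
  induction j generalizing X with
  | zero =>
    exact ⟨{X}, by simp, fun B _ hXB => ⟨X, by simp, hXB⟩, by
      intro L hL
      rw [Finset.mem_singleton.1 hL]
      exact Or.inl (by omega)⟩
  | succ j ih =>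
    by_cases hr : Robust F M X
    · refine ⟨{X}, by simpa using Nat.one_le_pow _ _ hM, fun B _ hXB => ⟨X, by simp, hXB⟩, ?_⟩
      intro L hL
      rw [Finset.mem_singleton.1 hL]
      exact Or.inr ⟨by omega, hr⟩
    -- Failure of robustness gives a transversal `Z` of at most `M` points; branch on the point of
    -- `Z` that a member contains.
    · simp only [Robust, not_forall, not_exists, not_and] at hr
      obtain ⟨Z, hZM, hXZ, hZ⟩ := hr
      have key : ∀ z ∈ Z, (insert z X).card + j = k := by
        intro z hz
        rw [Finset.card_insert_of_notMem (Finset.disjoint_right.1 hXZ hz)]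
        omega
      choose! C hC using fun z (hz : z ∈ Z) => ih (insert z X) (key z hz)
      refine ⟨Z.biUnion C, ?_, ?_, ?_⟩
      · calc (Z.biUnion C).card ≤ Z.card * M ^ j :=
              Finset.card_biUnion_le_card_mul _ _ _ fun z hz => (hC z hz).1
          _ ≤ M * M ^ j := Nat.mul_le_mul_right _ hZM
          _ = M ^ (j + 1) := (pow_succ' _ _).symm
      · intro B hB hXB
        obtain ⟨z, hzB, hzZ⟩ := Finset.not_disjoint_iff.1 (hZ B hB hXB)
        obtain ⟨L, hL, hLB⟩ := (hC z hzZ).2.1 B hB (Finset.insert_subset hzB hXB)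
        exact ⟨L, Finset.mem_biUnion.2 ⟨z, hzZ, hL⟩, hLB⟩
      · intro L hL
        obtain ⟨z, hz, hL⟩ := Finset.mem_biUnion.1 hL
        exact (hC z hz).2.2 L hL

/-- Pairwise intersecting pairs share an element, or form a triangle. -/
theorem exists_center_or_triangle {P : Finset (Finset α)} (h2 : ∀ e ∈ P, e.card = 2)
    (hP : ∀ e ∈ P, ∀ f ∈ P, ¬ Disjoint e f) (h1 : 1 < P.card) :
    (∃ x, ∀ e ∈ P, x ∈ e) ∨ ∃ a b c : α, {a, b} ∈ P ∧ {a, c} ∈ P ∧ {b, c} ∈ P ∧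
      P.card ≤ 3 := by
  obtain ⟨e, he, f, hf, hef⟩ := Finset.one_lt_card.1 h1
  obtain ⟨a, hae, haf⟩ := Finset.not_disjoint_iff.1 (hP e he f hf)
  by_cases ha : ∀ g ∈ P, a ∈ g
  · exact Or.inl ⟨a, ha⟩
  push Not at ha
  obtain ⟨g, hg, hag⟩ := ha
  have pair : ∀ e ∈ P, ∀ u ∈ e, ∀ v ∈ e, u ≠ v → e = {u, v} := fun e he u hu v hv huv =>
    (Finset.eq_of_subset_of_card_le (Finset.insert_subset hu (Finset.singleton_subset_iff.2 hv))
      (by rw [h2 e he, Finset.card_pair huv])).symm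
  -- A pair avoiding the common point of `e` and `f` must join their other ends, which closes the
  -- triangle.
  obtain ⟨b, hbe, hbg⟩ := Finset.not_disjoint_iff.1 (hP e he g hg)
  obtain ⟨c, hcf, hcg⟩ := Finset.not_disjoint_iff.1 (hP f hf g hg)
  have hab : a ≠ b := fun h => hag (h ▸ hbg)
  have hac : a ≠ c := fun h => hag (h ▸ hcg)
  have e1 := pair e he a hae b hbe hab
  have e2 := pair f hf a haf c hcf hac
  have hbc : b ≠ c := fun h => hef (by rw [e1, e2, h])
  have e3 := pair g hg b hbg c hcg hbc
  refine Or.inr ⟨a, b, c, e1 ▸ he, e2 ▸ hf, e3 ▸ hg, ?_⟩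
  have hsub : P ⊆ ({a, b, c} : Finset α).powersetCard 2 := by
    intro d hd
    refine Finset.mem_powersetCard.2 ⟨?_, h2 d hd⟩
    have m1 := hP d hd e he
    have m2 := hP d hd f hf
    have m3 := hP d hd g hg
    rw [e1] at m1
    rw [e2] at m2
    rw [e3] at m3
    simp only [Finset.disjoint_insert_right, Finset.disjoint_singleton_right] at m1 m2 m3
    obtain ⟨u, v, hu, hv, huv, hduv⟩ : ∃ u v, u ∈ ({a, b, c} : Finset α) ∧
        v ∈ ({a, b, c} : Finset α) ∧ u ≠ v ∧ d = {u, v} := by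
      by_cases da : a ∈ d
      · by_cases db : b ∈ d
        · exact ⟨a, b, by simp, by simp, hab, pair d hd a da b db hab⟩
        · have dc : c ∈ d := by tauto
          exact ⟨a, c, by simp, by simp, hac, pair d hd a da c dc hac⟩
      · have db : b ∈ d := by tauto
        have dc : c ∈ d := by tauto
        exact ⟨b, c, by simp, by simp, hbc, pair d hd b db c dc hbc⟩
    rw [hduv]
    exact Finset.insert_subset hu (Finset.singleton_subset_iff.2 hv)
  refine (Finset.card_le_card hsub).trans ?_
  rw [Finset.card_powersetCard]
  exact (Nat.choose_le_choose 2 Finset.card_le_three).trans (by decide)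

end Robust

/-! ### The threshold and binomial estimates -/

section Arithmetic

theorem threshold_eq {k s : ℕ} (hs : 1 ≤ s) (b : ℕ) :
    threshold k s b = k + (s - 1) * k / (b + 1) := by
  obtain ⟨r, rfl⟩ := Nat.exists_eq_add_of_le hs
  rw [threshold, show (1 + r + b) * k = (1 + r - 1) * k + k * (b + 1) by
    rw [Nat.add_sub_cancel_left]; ring, Nat.add_mul_div_right _ _ (Nat.succ_pos b), add_comm]

theorem threshold_anti {k s : ℕ} (hs : 1 ≤ s) {b c : ℕ} (h : b ≤ c) :
    threshold k s c ≤ threshold k s b := by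
  rw [threshold_eq hs, threshold_eq hs]
  exact Nat.add_le_add_left (Nat.div_le_div_left (by omega) (by omega)) _

theorem lt_threshold_succ (k s b : ℕ) : (s + b) * k < (b + 1) * (threshold k s b + 1) :=
  Nat.lt_mul_div_succ _ (Nat.succ_pos b)

/-- Once $c\ge(s-1)k$ the quotient in `threshold_eq` vanishes and the threshold is $k$. Boundedness
keeps the `sSup` in `betaHat` from taking its default value 0. -/
theorem bddAbove_threshold_eq {k s b : ℕ} (hs : 1 ≤ s) (h : k < threshold k s b) :
    BddAbove {c : ℕ | threshold k s c = threshold k s b} := by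
  refine ⟨(s - 1) * k, fun c hc => ?_⟩
  by_contra! hlt
  have h1 : threshold k s c = k := by
    rw [threshold_eq hs, Nat.div_eq_of_lt (by omega), add_zero]
  have : threshold k s c = threshold k s b := hc
  omega

theorem threshold_betaHat {k s : ℕ} (hs : 1 ≤ s) (b : ℕ) :
    threshold k s (betaHat k s b) = threshold k s b := by
  unfold betaHat
  split_ifs with h
  · exact Nat.sSup_mem (s := {c : ℕ | threshold k s c = threshold k s b}) ⟨b, rfl⟩
      (bddAbove_threshold_eq hs h)
  · rfl

theorem le_betaHat {k s b c : ℕ} (hs : 1 ≤ s) (h : k < threshold k s b)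
    (hc : threshold k s c = threshold k s b) : c ≤ betaHat k s b := by
  rw [betaHat, if_pos h]
  exact le_csSup (bddAbove_threshold_eq hs h) hc

theorem lt_of_threshold_le {k s b : ℕ} (hs : 1 ≤ s) (h : threshold k s b ≤ k) :
    (s - 1) * k < b + 1 := by
  rw [threshold_eq hs] at h
  exact Nat.lt_of_div_eq_zero (Nat.succ_pos b) (by simpa using h)

theorem choose_add_le (a d r : ℕ) :
    (a + d + 1).choose (r + 1) ≤ (a + 1).choose (r + 1) + d * (a + d).choose r := by
  induction d with
  | zero => simp
  | succ d ih =>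
    have h1 : (a + (d + 1) + 1).choose (r + 1) =
        (a + (d + 1)).choose r + (a + (d + 1)).choose (r + 1) := Nat.choose_succ_succ _ _
    have h2 : (a + d).choose r ≤ (a + (d + 1)).choose r := Nat.choose_le_choose r (by omega)
    have h3 := Nat.mul_le_mul_left d h2
    rw [← add_assoc a d 1] at h1 h2 h3 ⊢
    rw [Nat.succ_mul]
    omega

theorem choose_add_ge (a d r : ℕ) :
    a.choose (r + 1) + d * a.choose r ≤ (a + d).choose (r + 1) := by
  induction d with
  | zero => simp
  | succ d ih =>
    have h1 : (a + (d + 1)).choose (r + 1) = (a + d).choose r + (a + d).choose (r + 1) :=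
      Nat.choose_succ_succ _ _
    have h2 : a.choose r ≤ (a + d).choose r := Nat.choose_le_choose r (by omega)
    rw [Nat.succ_mul]
    omega

/-- The right side is at least $m\binom{n-m-1}{k-2}$, which differs from $m\binom{n-2}{k-2}$ by at
most $m(m-1)\binom{n-3}{k-3}$. For large `n` the spare $\binom{n-2}{k-2}$ absorbs this and the `K`
term. -/
theorem pairs_count_lt (n k m K : ℕ) (hk : 3 ≤ k) (hm : 1 ≤ m) (hn : m + k * (K + m * m) + 4 ≤ n) :
    (m - 1) * (n - 2).choose (k - 2) + K * (n - 3).choose (k - 3) <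
      (n - 1).choose (k - 1) - (n - m - 1).choose (k - 1) := by
  obtain ⟨r, rfl⟩ := Nat.exists_eq_add_of_le' hk
  obtain ⟨q, rfl⟩ := Nat.exists_eq_add_of_le' hm
  obtain ⟨a, rfl⟩ : ∃ a, n = a + q + 3 := ⟨n - q - 3, by omega⟩
  have h1 := choose_add_ge (a + 1) (q + 1) (r + 1)
  have h2 := choose_add_le a q r
  have h3 := Nat.add_one_mul_choose_eq (a + q) r
  rw [show a + q + 3 - 2 = a + q + 1 by omega, show r + 3 - 2 = r + 1 by omega,
    show a + q + 3 - 3 = a + q by omega, show r + 3 - 3 = r by omega,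
    show a + q + 3 - 1 = a + 1 + (q + 1) by omega, show r + 3 - 1 = r + 1 + 1 by omega,
    show a + q + 3 - (q + 1) - 1 = a + 1 by omega, show q + 1 - 1 = q by omega]
  have hW : 0 < (a + q).choose r := Nat.choose_pos (by
    have := Nat.mul_le_mul_left (r + 3)
      (show 1 ≤ K + (q + 1) * (q + 1) from Nat.le_add_left_of_le (Nat.mul_pos hm hm))
    omega)
  generalize (a + q + 1).choose (r + 1) = U at *
  generalize (a + q).choose r = W at *
  generalize (a + 1).choose (r + 1) = V at *
  have h4 : (K + (q + 1) * (q + 1)) * W < U := by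
    refine lt_of_mul_lt_mul_right (a := r + 1) ?_ (Nat.zero_le _)
    rw [← h3]
    calc (K + (q + 1) * (q + 1)) * W * (r + 1) = ((r + 1) * (K + (q + 1) * (q + 1))) * W := by ring
      _ < (a + q + 1) * W := Nat.mul_lt_mul_of_pos_right (by nlinarith) hW
  have h5 : q * U + K * W < (q + 1) * V := by nlinarith
  omega

end Arithmetic

/-! ### Counting star members and supersets -/

section Counting

variable {n : ℕ}

theorem card_star_disjoint (k : ℕ) (hk : 1 ≤ k) {x : Fin n} {U : Finset (Fin n)} (hx : x ∉ U) :
    ((star k x).filter fun B => Disjoint B U).card = (n - U.card - 1).choose (k - 1) := by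
  have h : (star k x).filter (fun B => Disjoint B U) =
      ((insert x U)ᶜ.powersetCard (k - 1)).image (insert x) := by
    ext B
    simp only [star, Finset.mem_filter, Finset.mem_powersetCard, Finset.mem_image,
      Finset.subset_univ, true_and]
    constructor
    · rintro ⟨⟨hB, hxB⟩, hd⟩
      refine ⟨B.erase x, ⟨?_, by rw [Finset.card_erase_of_mem hxB, hB]⟩, Finset.insert_erase hxB⟩
      intro y hy
      obtain ⟨hyx, hyB⟩ := Finset.mem_erase.1 hy
      simp only [Finset.mem_compl, Finset.mem_insert, not_or]
      exact ⟨hyx, Finset.disjoint_left.1 hd hyB⟩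
    · rintro ⟨D, ⟨hD, hDk⟩, rfl⟩
      have hxD : x ∉ D := fun h => by simpa using hD h
      refine ⟨⟨by rw [Finset.card_insert_of_notMem hxD]; omega, Finset.mem_insert_self _ _⟩, ?_⟩
      refine Finset.disjoint_insert_left.2 ⟨hx, Finset.disjoint_left.2 fun y hy hyU => ?_⟩
      have := hD hy
      simp only [Finset.mem_compl, Finset.mem_insert, not_or] at this
      exact this.2 hyU
  rw [h, Finset.card_image_of_injOn, Finset.card_powersetCard, Finset.card_compl,
    Finset.card_insert_of_notMem hx, Fintype.card_fin, Nat.sub_sub]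
  intro D hD E hE hDE
  have hxn : ∀ D ∈ ((insert x U)ᶜ.powersetCard (k - 1) : Finset (Finset (Fin n))), x ∉ D :=
    fun D hD h => by simpa using (Finset.mem_powersetCard.1 hD).1 h
  rw [← Finset.erase_insert (hxn D hD), hDE, Finset.erase_insert (hxn E hE)]

theorem card_star_not_disjoint (k : ℕ) (hk : 1 ≤ k) {x : Fin n} {U : Finset (Fin n)}
    (hx : x ∉ U) : ((star k x).filter fun B => ¬ Disjoint B U).card =
      (n - 1).choose (k - 1) - (n - U.card - 1).choose (k - 1) := by
  have h1 := card_star_disjoint k hk hx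
  have h2 := card_star_disjoint k hk (Finset.notMem_empty x)
  have h3 := Finset.card_filter_add_card_filter_not (s := star k x) (fun B => Disjoint B U)
  simp only [Finset.disjoint_empty_right, Finset.filter_true, Finset.card_empty, Nat.sub_zero]
    at h2
  omega

theorem card_filter_superset_le (k : ℕ) (L : Finset (Fin n)) :
    (((Finset.univ : Finset (Fin n)).powersetCard k).filter fun B => L ⊆ B).card ≤
      (n - L.card).choose (k - L.card) := by
  have h : (((Finset.univ : Finset (Fin n)).powersetCard k).filter fun B => L ⊆ B).card ≤
      (Lᶜ.powersetCard (k - L.card)).card := by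
    refine Finset.card_le_card_of_injOn (· \ L) ?_ ?_
    · intro B hB
      obtain ⟨hB, hLB⟩ := Finset.mem_filter.1 hB
      refine Finset.mem_powersetCard.2 ⟨?_, ?_⟩
      · intro y hy
        exact Finset.mem_compl.2 (Finset.mem_sdiff.1 hy).2
      · rw [Finset.card_sdiff_of_subset hLB, (Finset.mem_powersetCard.1 hB).2]
    · intro B hB C hC hBC
      have hBC : B \ L = C \ L := hBC
      rw [← Finset.sdiff_union_of_subset (Finset.mem_filter.1 hB).2, hBC,
        Finset.sdiff_union_of_subset (Finset.mem_filter.1 hC).2]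
  rwa [Finset.card_powersetCard, Finset.card_compl, Fintype.card_fin] at h

theorem choose_sub_le_choose_sub (n k : ℕ) {i j : ℕ} (hij : i ≤ j) (hj : j ≤ k) (hk : k ≤ n) :
    (n - j).choose (k - j) ≤ (n - i).choose (k - i) := by
  rw [← Nat.choose_symm (show k - j ≤ n - j by omega),
    ← Nat.choose_symm (show k - i ≤ n - i by omega),
    show n - j - (k - j) = n - k by omega, show n - i - (k - i) = n - k by omega]
  exact Nat.choose_le_choose _ (by omega)

end Counting

/-! ### Double counting incidences with `Y` -/

section Multiplicity

variable {α ι : Type*} [DecidableEq α] [Fintype ι] {k s b : ℕ} {A : ι → Finset α} {Y : Finset α}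

theorem mul_le_sum_card_inter (hι : Fintype.card ι = s + b)
    (hY : ∀ y ∈ Y, (Finset.univ.filter fun i => y ∉ A i).card < s) :
    Y.card * (b + 1) ≤ ∑ i, (A i ∩ Y).card := by
  have h : ∀ i, (A i ∩ Y).card = ∑ y ∈ Y, if y ∈ A i then 1 else 0 := by
    intro i
    rw [← Finset.card_filter, Finset.inter_comm, Finset.filter_mem_eq_inter]
  simp only [h]
  rw [Finset.sum_comm, ← smul_eq_mul]
  refine Finset.card_nsmul_le_sum _ _ _ fun y hy => ?_
  rw [← Finset.card_filter]
  have h1 := Finset.card_filter_add_card_filter_not (s := (Finset.univ : Finset ι))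
    (fun i => y ∈ A i)
  have h2 := hY y hy
  rw [Finset.card_univ] at h1
  omega

theorem card_le_threshold (hι : Fintype.card ι = s + b) (hA : ∀ i, (A i).card = k)
    (hY : ∀ y ∈ Y, (Finset.univ.filter fun i => y ∉ A i).card < s) :
    Y.card ≤ threshold k s b := by
  refine (Nat.le_div_iff_mul_le (Nat.succ_pos b)).2 ((mul_le_sum_card_inter hι hY).trans ?_)
  rw [← hι, ← smul_eq_mul, ← Finset.card_univ]
  exact Finset.sum_le_card_nsmul _ _ _ fun i _ =>
    (Finset.card_le_card Finset.inter_subset_left).trans (hA i).le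

/-- If `Y` has the largest possible size, a set avoiding `Y` meets at most `b` of the `A i`. -/
theorem card_filter_not_disjoint_le (hι : Fintype.card ι = s + b) (hA : ∀ i, (A i).card = k)
    (hY : ∀ y ∈ Y, (Finset.univ.filter fun i => y ∉ A i).card < s)
    (hYb : threshold k s b ≤ Y.card) {W : Finset α} (hW : Disjoint W Y) :
    (Finset.univ.filter fun i => ¬ Disjoint W (A i)).card ≤ b := by
  -- The floor in `threshold` leaves at most `b` incidences outside `Y`, and each `A i` met by `W`
  -- uses one of them.
  have h1 := mul_le_sum_card_inter hι hY
  have h2 := lt_threshold_succ k s b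
  have h3 : ∑ i, (A i ∩ Y).card + ∑ i, (A i \ Y).card = (s + b) * k := by
    rw [← Finset.sum_add_distrib, ← hι, ← smul_eq_mul, ← Finset.card_univ]
    exact Finset.sum_eq_card_nsmul fun i _ => by rw [Finset.card_inter_add_card_sdiff, hA i]
  have h4 : (Finset.univ.filter fun i => ¬ Disjoint W (A i)).card ≤ ∑ i, (A i \ Y).card := by
    rw [Finset.card_filter]
    refine Finset.sum_le_sum fun i _ => ?_
    split_ifs with h
    · exact Nat.zero_le _
    · obtain ⟨w, hw, hwA⟩ := Finset.not_disjoint_iff.1 h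
      exact Finset.card_pos.2 ⟨w, Finset.mem_sdiff.2 ⟨hwA, Finset.disjoint_left.1 hW hw⟩⟩
  have h5 := Nat.mul_le_mul_left (b + 1) (Nat.add_le_add_right hYb 1)
  have h6 : (b + 1) * (Y.card + 1) = Y.card * (b + 1) + (b + 1) := by ring
  omega

theorem le_card_filter_disjoint (hι : Fintype.card ι = s + b) (hA : ∀ i, (A i).card = k)
    (hY : ∀ y ∈ Y, (Finset.univ.filter fun i => y ∉ A i).card < s)
    (hYb : threshold k s b ≤ Y.card) {W : Finset α} (hW : Disjoint W Y) :
    s ≤ (Finset.univ.filter fun i => Disjoint W (A i)).card := by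
  have h1 := card_filter_not_disjoint_le hι hA hY hYb hW
  have h2 := Finset.card_filter_add_card_filter_not (s := (Finset.univ : Finset ι))
    (fun i => Disjoint W (A i))
  rw [Finset.card_univ] at h2
  omega

/-- When `k` elements are each missed by fewer than `s` of the distinct sets `A i`, there are few
sets. -/
theorem card_le_of_card_eq (hι : Fintype.card ι = s + b)
    (hA : ∀ i, (A i).card = k) (hAi : Function.Injective A)
    (hY : ∀ y ∈ Y, (Finset.univ.filter fun i => y ∉ A i).card < s) (hYk : Y.card = k) :
    s + b ≤ (s - 1) * k + 1 := by
  classical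
  -- A set other than `Y` has the same size, so it misses some `y ∈ Y`; each `y` is missed at most
  -- `s - 1` times.
  have h1 : (Finset.univ.filter fun i => A i ≠ Y) ⊆
      Y.biUnion fun y => Finset.univ.filter fun i => y ∉ A i := by
    intro i hi
    have hne := (Finset.mem_filter.1 hi).2
    by_contra h
    simp only [Finset.mem_biUnion, Finset.mem_filter, Finset.mem_univ, true_and, not_exists,
      not_and, not_not] at h
    exact hne (Finset.eq_of_subset_of_card_le h (by rw [hA i, hYk])).symm
  have h2 := (Finset.card_le_card h1).trans
    (Finset.card_biUnion_le_card_mul _ _ (s - 1) fun y hy => Nat.le_sub_one_of_lt (hY y hy))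
  have h3 : (Finset.univ.filter fun i => A i = Y).card ≤ 1 := by
    refine Finset.card_le_one.2 fun i hi j hj => hAi ?_
    rw [(Finset.mem_filter.1 hi).2, (Finset.mem_filter.1 hj).2]
  have h4 := Finset.card_filter_add_card_filter_not (s := (Finset.univ : Finset ι))
    (fun i => A i = Y)
  rw [Finset.card_univ] at h4
  rw [hYk, mul_comm] at h2
  simp only [ne_eq] at h2
  omega

end Multiplicity

/-! ### Finding the centre and bounding the family -/

section Centered

variable {n k s t β : ℕ} {F : Finset (Finset (Fin n))} {x : Fin n} {Y : Finset (Fin n)}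

/-- Each element of the set `Y`, of size `threshold k s β`, lies in all but fewer than `s` of the
members of `F` that avoid `x`, and there are at least `s + β` such members. -/
structure IsCentered (k s β : ℕ) (F : Finset (Finset (Fin n))) (x : Fin n)
    (Y : Finset (Fin n)) : Prop where
  card_eq : Y.card = threshold k s β
  notMem : x ∉ Y
  card_lt : ∀ y ∈ Y, ((F.filter fun B => x ∉ B).filter fun B => y ∉ B).card < s
  le_card : s + β ≤ (F.filter fun B => x ∉ B).card

theorem card_filter_coe {α : Type*} (G : Finset α) (p : α → Prop) [DecidablePred p] :
    (Finset.univ.filter fun i : G => p i.1).card = (G.filter p).card := by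
  rw [Finset.card_filter, Finset.card_filter, Finset.sum_coe_sort G fun B => if p B then 1 else 0]

theorem card_le_of_cover (hn : k ≤ n)
    (hF : F ⊆ (Finset.univ : Finset (Fin n)).powersetCard k) (C : Finset (Finset (Fin n)))
    (hC : ∀ L ∈ C, 2 ≤ L.card ∧ L.card ≤ k) (hFC : ∀ B ∈ F, ∃ L ∈ C, L ⊆ B) :
    F.card ≤ (C.filter fun L => L.card = 2).card * (n - 2).choose (k - 2) +
      C.card * (n - 3).choose (k - 3) := by
  have h1 : F ⊆ C.biUnion fun L =>
      ((Finset.univ : Finset (Fin n)).powersetCard k).filter fun B => L ⊆ B := by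
    intro B hB
    obtain ⟨L, hL, hLB⟩ := hFC B hB
    exact Finset.mem_biUnion.2 ⟨L, hL, Finset.mem_filter.2 ⟨hF hB, hLB⟩⟩
  refine (Finset.card_le_card h1).trans (Finset.card_biUnion_le.trans ?_)
  rw [← Finset.sum_filter_add_sum_filter_not C fun L => L.card = 2]
  refine Nat.add_le_add ?_ ?_
  · rw [← smul_eq_mul]
    refine Finset.sum_le_card_nsmul _ _ _ fun L hL => ?_
    have := card_filter_superset_le k L
    rwa [(Finset.mem_filter.1 hL).2] at this
  · refine le_trans ?_ (Nat.mul_le_mul_right _ (Finset.card_filter_le C fun L => ¬ L.card = 2))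
    rw [← smul_eq_mul]
    refine Finset.sum_le_card_nsmul _ _ _ fun L hL => (card_filter_superset_le k L).trans ?_
    obtain ⟨hL, hL2⟩ := Finset.mem_filter.1 hL
    have := hC L hL
    exact choose_sub_le_choose_sub n k (by omega) this.2 hn

/-- A member meeting all three pairs contains two of `a`, `b`, `c`, and any two such members meet.
-/
theorem ell_le_of_triangle {α : Type*} [DecidableEq α] {F : Finset (Finset α)} {a b c : α}
    {r : ℕ} (hab : (F.filter fun B => Disjoint {a, b} B).card ≤ r)
    (hac : (F.filter fun B => Disjoint {a, c} B).card ≤ r)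
    (hbc : (F.filter fun B => Disjoint {b, c} B).card ≤ r) : ell F ≤ 3 * r := by
  set R := (F.filter fun B => Disjoint {a, b} B) ∪ (F.filter fun B => Disjoint {a, c} B) ∪
    (F.filter fun B => Disjoint {b, c} B) with hR
  have h1 : R.card ≤ 3 * r := by
    rw [hR]
    have := Finset.card_union_le ((F.filter fun B => Disjoint {a, b} B) ∪
      (F.filter fun B => Disjoint {a, c} B)) (F.filter fun B => Disjoint {b, c} B)
    have := Finset.card_union_le (F.filter fun B => Disjoint {a, b} B)
      (F.filter fun B => Disjoint {a, c} B)
    omega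
  refine (ell_le (R := R) ?_ ?_).trans h1
  · exact Finset.union_subset (Finset.union_subset (Finset.filter_subset _ _)
      (Finset.filter_subset _ _)) (Finset.filter_subset _ _)
  · intro B hB D hD
    simp only [hR, Finset.coe_sdiff, Set.mem_sdiff, Finset.mem_coe, Finset.mem_union,
      Finset.mem_filter, Finset.disjoint_insert_left, Finset.disjoint_singleton_left,
      not_or, not_and, not_not] at hB hD
    obtain ⟨hBF, ⟨B1, B2⟩, B3⟩ := hB
    obtain ⟨hDF, ⟨D1, D2⟩, D3⟩ := hD
    have B1 := B1 hBF
    have B2 := B2 hBF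
    have B3 := B3 hBF
    have D1 := D1 hDF
    have D2 := D2 hDF
    have D3 := D3 hDF
    rw [Finset.not_disjoint_iff]
    by_contra! h
    have ha := h a
    have hb := h b
    have hc := h c
    clear h hab hac hbc hR h1
    by_cases a ∈ B <;> by_cases b ∈ B <;> simp_all

theorem exists_isCentered (hk : 3 ≤ k) (hs : 1 ≤ s)
    (hn : threshold k s β + k * (((s + t + 1) * k) ^ k + threshold k s β * threshold k s β) + 4 ≤ n)
    (hF : F ⊆ (Finset.univ : Finset (Fin n)).powersetCard k) (hUI : IsUnionIntersecting s t F)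
    (hl : s + β ≤ ell F)
    (hcard : (n - 1).choose (k - 1) - (n - threshold k s β - 1).choose (k - 1) ≤ F.card) :
    ∃ x Y, IsCentered k s β F x Y := by
  have hFk : ∀ B ∈ F, B.card = k := fun B hB => (Finset.mem_powersetCard.1 (hF hB)).2
  have hkm : k ≤ threshold k s β := by rw [threshold_eq hs]; exact Nat.le_add_right _ _
  obtain ⟨C, hCM, hFC, hC⟩ := exists_robust_cover (k := k) (M := (s + t + 1) * k) F
    (Nat.mul_pos (by omega) (by omega)) k ∅ (by simp)
  have hM : (s + t) * k ≤ (s + t + 1) * k := Nat.mul_le_mul_right _ (by omega)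
  have hC2 : ∀ L ∈ C, 2 ≤ L.card ∧ L.card ≤ k := by
    intro L hL
    rcases hC L hL with h | ⟨h, hr⟩
    · omega
    · exact ⟨hr.two_le_card hFk hUI (by omega) hM (by omega), h.le⟩
  set P := C.filter fun L => L.card = 2 with hP
  have hP2 : ∀ e ∈ P, e.card = 2 := fun e he => (Finset.mem_filter.1 he).2
  have hPr : ∀ e ∈ P, Robust F ((s + t + 1) * k) e := by
    intro e he
    rcases hC e (Finset.mem_filter.1 he).1 with h | h
    · have := hP2 e he
      omega
    · exact h.2
  have hPm : threshold k s β ≤ P.card := by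
    by_contra! hlt
    have h1 := card_le_of_cover (by omega) hF C hC2
      fun B hB => hFC B hB (Finset.empty_subset B)
    rw [← hP] at h1
    have h2 := pairs_count_lt n k (threshold k s β) (((s + t + 1) * k) ^ k) hk (by omega) hn
    have h3 : P.card * (n - 2).choose (k - 2) ≤ (threshold k s β - 1) * (n - 2).choose (k - 2) :=
      Nat.mul_le_mul_right _ (by omega)
    have h4 := Nat.mul_le_mul_right ((n - 3).choose (k - 3)) hCM
    omega
  have hmiss : ∀ e ∈ P, (F.filter fun B => Disjoint e B).card < s := fun e he =>
    (hPr e he).card_filter_disjoint_lt hFk hUI (by rw [hP2 e he]; omega) hM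
  rcases exists_center_or_triangle hP2
    (fun e he f hf => (hPr e he).not_disjoint (hPr f hf) hFk hUI
      (by rw [hP2 e he]; omega) (by rw [hP2 f hf]; omega) le_rfl) (by omega) with
    ⟨x, hx⟩ | ⟨a, b, c, hab, hac, hbc, hP3⟩
  · set Y := Finset.univ.filter fun y => y ≠ x ∧ {x, y} ∈ P with hY
    have hPY : P.card ≤ Y.card := by
      refine (Finset.card_le_card (t := Y.image fun y => {x, y}) ?_).trans Finset.card_image_le
      intro e he
      obtain ⟨y, hy⟩ := Finset.card_eq_one.1
        (show (e.erase x).card = 1 by rw [Finset.card_erase_of_mem (hx e he), hP2 e he])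
      have he' : insert x {y} = e := by rw [← hy, Finset.insert_erase (hx e he)]
      have hyx : y ≠ x := (Finset.mem_erase.1 (hy ▸ Finset.mem_singleton_self y)).1
      exact Finset.mem_image.2 ⟨y, Finset.mem_filter.2 ⟨Finset.mem_univ _, hyx, he'.symm ▸ he⟩, he'⟩
    have hlt : ∀ y ∈ Y, ((F.filter fun B => x ∉ B).filter fun B => y ∉ B).card < s := by
      intro y hy
      have := hmiss _ (Finset.mem_filter.1 hy).2.2
      rw [Finset.filter_filter]
      simpa only [Finset.disjoint_insert_left, Finset.disjoint_singleton_left] using this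
    have hle := hl.trans (ell_le_card_notMem F x)
    -- Here `b ≥ β` is the exact excess, so `Y.card` is squeezed between `threshold k s β` and
    -- `threshold k s b`.
    obtain ⟨b, hb⟩ := Nat.exists_eq_add_of_le (show s ≤ (F.filter fun B => x ∉ B).card by omega)
    have h1 : Y.card ≤ threshold k s b := by
      refine card_le_threshold (ι := F.filter fun B => x ∉ B) (A := Subtype.val)
        (by rw [Fintype.card_coe, hb]) (fun i => hFk _ (Finset.mem_filter.1 i.2).1) ?_
      intro y hy
      exact (card_filter_coe _ fun B => y ∉ B).trans_lt (hlt y hy)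
    have h2 : threshold k s b ≤ threshold k s β := threshold_anti hs (by omega)
    exact ⟨x, Y, by omega, by simp [hY], hlt, hle⟩
  -- A triangle has three pairs, so $k\le m_\beta\le3$ forces $k=m_\beta=3$ and $3(s-1)\le\beta$,
  -- while the triangle gives $\ell\le3(s-1)$.
  · have h1 := lt_of_threshold_le (k := k) (b := β) hs (by omega)
    obtain rfl : k = 3 := by omega
    have h2 := ell_le_of_triangle (Nat.le_sub_one_of_lt (hmiss _ hab))
      (Nat.le_sub_one_of_lt (hmiss _ hac)) (Nat.le_sub_one_of_lt (hmiss _ hbc))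
    omega

theorem IsCentered.exists_card_eq (h : IsCentered k s β F x Y) (hs : 1 ≤ s)
    (hF : ∀ B ∈ F, B.card = k) : ∃ b, (F.filter fun B => x ∉ B).card = s + b ∧
      threshold k s b = threshold k s β ∧ b ≤ betaHat k s β := by
  have hle := h.le_card
  obtain ⟨b, hb⟩ := Nat.exists_eq_add_of_le (show s ≤ (F.filter fun B => x ∉ B).card by omega)
  have hlt : ∀ y ∈ Y,
      (Finset.univ.filter fun i : F.filter (fun B => x ∉ B) => y ∉ i.1).card < s := by
    intro y hy
    exact (card_filter_coe _ fun B => y ∉ B).trans_lt (h.card_lt y hy)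
  have hA : ∀ i : F.filter (fun B => x ∉ B), i.1.card = k :=
    fun i => hF _ (Finset.mem_filter.1 i.2).1
  have hι : Fintype.card (F.filter fun B => x ∉ B) = s + b := by rw [Fintype.card_coe, hb]
  have h1 := card_le_threshold hι hA hlt
  rw [h.card_eq] at h1
  have h2 : threshold k s b = threshold k s β := le_antisymm (threshold_anti hs (by omega)) h1
  refine ⟨b, hb, h2, ?_⟩
  by_cases hkm : k < threshold k s β
  · exact le_betaHat hs hkm h2
  · have h3 : k ≤ threshold k s β := by rw [threshold_eq hs]; exact Nat.le_add_right _ _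
    -- When $m_\beta=k$ the threshold no longer bounds `b`; distinctness of the members does.
    have h4 := card_le_of_card_eq hι hA Subtype.val_injective hlt (by rw [h.card_eq]; omega)
    have h5 := lt_of_threshold_le (k := k) (b := β) hs (by omega)
    rw [betaHat, if_neg hkm]
    omega

/-- The union of `t` such members avoids `Y`, hence misses `s` of the members avoiding `x`, against
union intersection. -/
theorem IsCentered.card_filter_disjoint_lt (h : IsCentered k s β F x Y) (hs : 1 ≤ s)
    (hF : ∀ B ∈ F, B.card = k) (hUI : IsUnionIntersecting s t F) :
    ((F.filter fun B => x ∈ B).filter fun B => Disjoint B Y).card < t := by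
  by_contra! hlt
  obtain ⟨b, hb, hbm, -⟩ := h.exists_card_eq hs hF
  obtain ⟨Q, hQ, hQt⟩ := Finset.exists_subset_card_eq hlt
  have hW : Disjoint (Q.biUnion id) Y :=
    (Finset.disjoint_biUnion_left _ _ _).2 fun B hB => (Finset.mem_filter.1 (hQ hB)).2
  have h1 := le_card_filter_disjoint (ι := F.filter fun B => x ∉ B) (A := Subtype.val)
    (by rw [Fintype.card_coe, hb]) (fun i => hF _ (Finset.mem_filter.1 i.2).1)
    (fun y hy => (card_filter_coe _ fun B => y ∉ B).trans_lt (h.card_lt y hy))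
    (by rw [h.card_eq, hbm]) hW
  replace h1 := h1.trans_eq (card_filter_coe _ fun B => Disjoint (Q.biUnion id) B)
  obtain ⟨P, hP, hPs⟩ := Finset.exists_subset_card_eq h1
  have hP' : ∀ B ∈ P, (B ∈ F ∧ x ∉ B) ∧ Disjoint (Q.biUnion id) B := fun B hB => by
    simpa only [Finset.mem_filter] using hP hB
  have hQ' : ∀ B ∈ Q, (B ∈ F ∧ x ∈ B) ∧ Disjoint B Y := fun B hB => by
    simpa only [Finset.mem_filter] using hQ hB
  obtain ⟨z, hz⟩ := hUI P Q (fun B hB => (hP' B hB).1.1) (fun B hB => (hQ' B hB).1.1)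
    (Finset.disjoint_left.2 fun B hBP hBQ => (hP' B hBP).1.2 (hQ' B hBQ).1.2) hPs hQt
  obtain ⟨hzP, hzQ⟩ := Finset.mem_inter.1 hz
  obtain ⟨B, hB, hzB⟩ := Finset.mem_biUnion.1 hzP
  exact Finset.disjoint_left.1 (hP' B hB).2 hzQ hzB

theorem card_eq_add_filter (F : Finset (Finset (Fin n))) (x : Fin n) (Y : Finset (Fin n)) :
    F.card = ((F.filter fun B => x ∈ B).filter fun B => ¬ Disjoint B Y).card +
      (F.filter fun B => x ∉ B).card +
      ((F.filter fun B => x ∈ B).filter fun B => Disjoint B Y).card := by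
  have h1 := Finset.card_filter_add_card_filter_not (s := F) (fun B => x ∈ B)
  have h2 := Finset.card_filter_add_card_filter_not (s := F.filter fun B => x ∈ B)
    (fun B => Disjoint B Y)
  omega

theorem filter_subset_star (hF : F ⊆ (Finset.univ : Finset (Fin n)).powersetCard k) (x : Fin n)
    (Y : Finset (Fin n)) : ((F.filter fun B => x ∈ B).filter fun B => ¬ Disjoint B Y) ⊆
      (star k x).filter fun B => ¬ Disjoint B Y :=
  Finset.filter_subset_filter _ (Finset.filter_subset_filter _ hF)

theorem IsCentered.card_le (h : IsCentered k s β F x Y) (hk : 1 ≤ k) (hs : 1 ≤ s)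
    (hF : F ⊆ (Finset.univ : Finset (Fin n)).powersetCard k) (hUI : IsUnionIntersecting s t F) :
    F.card ≤ (n - 1).choose (k - 1) - (n - threshold k s β - 1).choose (k - 1) +
      (s + t + betaHat k s β - 1) := by
  have hFk : ∀ B ∈ F, B.card = k := fun B hB => (Finset.mem_powersetCard.1 (hF hB)).2
  obtain ⟨b, hb, -, hbb⟩ := h.exists_card_eq hs hFk
  have h1 := card_eq_add_filter F x Y
  have h2 := Finset.card_le_card (filter_subset_star hF x Y)
  rw [card_star_not_disjoint k hk h.notMem, h.card_eq] at h2
  have h3 := h.card_filter_disjoint_lt hs hFk hUI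
  omega

/-- The families attaining the bound. -/
theorem IsCentered.extremal (h : IsCentered k s β F x Y) (hk : 1 ≤ k) (hs : 1 ≤ s)
    (hF : F ⊆ (Finset.univ : Finset (Fin n)).powersetCard k) (hUI : IsUnionIntersecting s t F)
    (hcard : F.card = (n - 1).choose (k - 1) - (n - threshold k s β - 1).choose (k - 1) +
      (s + t + betaHat k s β - 1)) :
    (F.filter fun B => x ∉ B).card = s + betaHat k s β ∧
      ((F.filter fun B => x ∈ B).filter fun B => Disjoint B Y).card = t - 1 ∧
      ((F.filter fun B => x ∈ B).filter fun B => ¬ Disjoint B Y) =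
        (star k x).filter fun B => ¬ Disjoint B Y := by
  have hFk : ∀ B ∈ F, B.card = k := fun B hB => (Finset.mem_powersetCard.1 (hF hB)).2
  obtain ⟨b, hb, -, hbb⟩ := h.exists_card_eq hs hFk
  have h1 := card_eq_add_filter F x Y
  have h2 := Finset.card_le_card (filter_subset_star hF x Y)
  have h4 := card_star_not_disjoint k hk h.notMem
  rw [h.card_eq] at h4
  have h3 := h.card_filter_disjoint_lt hs hFk hUI
  exact ⟨by omega, by omega, Finset.eq_of_subset_of_card_le (filter_subset_star hF x Y) (by omega)⟩

end Centered

/-! ### The star members selected by the `A i` -/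

section StarMeeting

variable {n k s b : ℕ} {A : Fin (s + b) → Finset (Fin n)} {Y : Finset (Fin n)}

theorem mem_manyFold_iff {y : Fin n} :
    y ∈ manyFold s b A ↔ (Finset.univ.filter fun i => y ∉ A i).card < s := by
  have h := Finset.card_filter_add_card_filter_not (s := (Finset.univ : Finset (Fin (s + b))))
    (fun i => y ∈ A i)
  rw [Finset.card_univ, Fintype.card_fin] at h
  rw [manyFold, Finset.mem_filter, and_iff_right (Finset.mem_univ y)]
  constructor
  · rintro ⟨I, hI, hIA⟩
    have := Finset.card_le_card (show I ⊆ Finset.univ.filter fun i => y ∈ A i from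
      fun i hi => Finset.mem_filter.2 ⟨Finset.mem_univ i, hIA i hi⟩)
    omega
  · intro hlt
    obtain ⟨I, hI, hIb⟩ := Finset.exists_subset_card_eq
      (show b + 1 ≤ (Finset.univ.filter fun i => y ∈ A i).card by omega)
    exact ⟨I, hIb, fun i hi => (Finset.mem_filter.1 (hI hi)).2⟩

/-- A set avoiding `Y` misses at least `s` of the `A i`; one containing `y ∈ Y` misses only sets
that miss `y`, at most `s - 1`. -/
theorem starMeeting_eq (x : Fin n) (hs : 1 ≤ s) (hA : ∀ i, (A i).card = k)
    (hY : ∀ y ∈ Y, (Finset.univ.filter fun i => y ∉ A i).card < s)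
    (hYb : threshold k s b ≤ Y.card) :
    starMeeting k s b x A = (star k x).filter fun B => ¬ Disjoint B Y := by
  refine Finset.filter_congr fun B _ => ⟨fun hB hBY => ?_, fun hB => ?_⟩
  · have := le_card_filter_disjoint (Fintype.card_fin _) hA hY hYb hBY
    omega
  · obtain ⟨y, hyB, hyY⟩ := Finset.not_disjoint_iff.1 hB
    refine Nat.le_sub_one_of_lt ((Finset.card_le_card ?_).trans_lt (hY y hyY))
    intro i hi
    simp only [Finset.mem_filter, Finset.mem_univ, true_and] at hi ⊢
    exact Finset.disjoint_left.1 hi hyB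

end StarMeeting

/-! ### Invariance under permutations of the ground set -/

section Transport

theorem injective_map {α : Type*} (σ : Equiv.Perm α) :
    Function.Injective fun B : Finset α => B.map σ.toEmbedding :=
  Finset.map_injective _

variable {α : Type*} [DecidableEq α]

theorem Isomorphic.card_eq {F G : Finset (Finset α)} (h : Isomorphic F G) : F.card = G.card := by
  obtain ⟨σ, rfl⟩ := h
  exact Finset.card_image_of_injective _ (injective_map σ)

theorem isomorphic_image (F : Finset (Finset α)) (σ : Equiv.Perm α) :
    Isomorphic F (F.image fun B => B.map σ.toEmbedding) := by
  refine ⟨σ.symm, ?_⟩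
  have h : (fun B : Finset α => (B.map σ.toEmbedding).map σ.symm.toEmbedding) = id := by
    funext B
    ext y
    simp [Finset.mem_map_equiv]
  rw [Finset.image_image, Function.comp_def, h, Finset.image_id]

theorem IsUnionIntersecting.image {s t : ℕ} {F : Finset (Finset α)}
    (h : IsUnionIntersecting s t F) (σ : Equiv.Perm α) :
    IsUnionIntersecting s t (F.image fun B => B.map σ.toEmbedding) := by
  have hi : Function.Injective fun B : Finset α => B.map σ.toEmbedding := injective_map σ
  intro P Q hP hQ hPQ hPs hQt
  obtain ⟨P, hPF, rfl⟩ := Finset.subset_image_iff.1 hP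
  obtain ⟨Q, hQF, rfl⟩ := Finset.subset_image_iff.1 hQ
  rw [Finset.card_image_of_injective _ hi] at hPs hQt
  rw [Finset.disjoint_image hi] at hPQ
  obtain ⟨z, hz⟩ := h P Q (by exact_mod_cast hPF) (by exact_mod_cast hQF) hPQ hPs hQt
  refine ⟨σ z, ?_⟩
  simpa [Finset.mem_inter, Finset.mem_biUnion] using hz

theorem IsCentered.image {n k s β : ℕ} {F : Finset (Finset (Fin n))} {x : Fin n}
    {Y : Finset (Fin n)} (h : IsCentered k s β F x Y) (σ : Equiv.Perm (Fin n)) :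
    IsCentered k s β (F.image fun B => B.map σ.toEmbedding) (σ x) (Y.map σ.toEmbedding) := by
  refine ⟨by rw [Finset.card_map, h.card_eq], by simpa using h.notMem, ?_, ?_⟩
  · intro y' hy'
    obtain ⟨y, hy, rfl⟩ := Finset.mem_map.1 hy'
    rw [Finset.filter_image, Finset.filter_image,
      Finset.card_image_of_injective _ (injective_map σ)]
    simpa using h.card_lt y hy
  · rw [Finset.filter_image, Finset.card_image_of_injective _ (injective_map σ)]
    simpa using h.le_card

end Transport

/-! ### Structure and size of the extremal families -/

/-- A family attaining the bound, with centre `x`, is described by its members avoiding `x` and its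
members containing `x` that are disjoint from `Y`. -/
theorem IsCentered.exists_description {n k s t β : ℕ} {F : Finset (Finset (Fin n))} {x : Fin n}
    {Y : Finset (Fin n)} (h : IsCentered k s β F x Y) (hk : 1 ≤ k) (hs : 1 ≤ s)
    (hF : F ⊆ (Finset.univ : Finset (Fin n)).powersetCard k) (hUI : IsUnionIntersecting s t F)
    (hcard : F.card = (n - 1).choose (k - 1) - (n - threshold k s β - 1).choose (k - 1) +
      (s + t + betaHat k s β - 1)) :
    ∃ (A : Fin (s + betaHat k s β) → Finset (Fin n)) (G : Fin (t - 1) → Finset (Fin n)),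
      (∀ i, (A i).card = k) ∧ (∀ j, (G j).card = k) ∧
      Function.Injective A ∧ Function.Injective G ∧ (∀ i j, A i ≠ G j) ∧ (∀ i, x ∉ A i) ∧
      (manyFold s (betaHat k s β) A).card = threshold k s β ∧
      (∀ j, G j ∈ star k x \ starMeeting k s (betaHat k s β) x A) ∧
      IsUnionIntersecting s t (Finset.univ.image A ∪ Finset.univ.image G) ∧
      F = starMeeting k s (betaHat k s β) x A ∪ Finset.univ.image A ∪ Finset.univ.image G := by
  have hFk : ∀ B ∈ F, B.card = k := fun B hB => (Finset.mem_powersetCard.1 (hF hB)).2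
  obtain ⟨hA, hG, hH⟩ := h.extremal hk hs hF hUI hcard
  set 𝒜 := F.filter fun B => x ∉ B with h𝒜
  set 𝒢 := (F.filter fun B => x ∈ B).filter fun B => Disjoint B Y with h𝒢
  let eA := (𝒜.equivFinOfCardEq hA).symm
  let eG := (𝒢.equivFinOfCardEq hG).symm
  have mA : ∀ i, (eA i).1 ∈ F ∧ x ∉ (eA i).1 := fun i => Finset.mem_filter.1 (eA i).2
  have mG : ∀ j, ((eG j).1 ∈ F ∧ x ∈ (eG j).1) ∧ Disjoint (eG j).1 Y := fun j => by
    simpa only [h𝒢, Finset.mem_filter] using (eG j).2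
  have iA : Finset.univ.image (fun i => (eA i).1) = 𝒜 := by
    ext B
    simp only [Finset.mem_image, Finset.mem_univ, true_and]
    exact ⟨fun ⟨i, hi⟩ => hi ▸ (eA i).2, fun hB => ⟨eA.symm ⟨B, hB⟩, by simp⟩⟩
  have iG : Finset.univ.image (fun i => (eG i).1) = 𝒢 := by
    ext B
    simp only [Finset.mem_image, Finset.mem_univ, true_and]
    exact ⟨fun ⟨i, hi⟩ => hi ▸ (eG i).2, fun hB => ⟨eG.symm ⟨B, hB⟩, by simp⟩⟩
  have hAk : ∀ i, (eA i).1.card = k := fun i => hFk _ (mA i).1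
  have hAinj : Function.Injective fun i => (eA i).1 := Subtype.val_injective.comp eA.injective
  have hY : ∀ y ∈ Y, (Finset.univ.filter fun i => y ∉ (eA i).1).card < s := by
    intro y hy
    have := h.card_lt y hy
    rwa [← h𝒜, ← iA, Finset.filter_image, Finset.card_image_of_injective _ hAinj] at this
  have hthr := threshold_betaHat (k := k) hs β
  have hsm := starMeeting_eq (b := betaHat k s β) x hs hAk hY (by rw [h.card_eq, hthr])
  refine ⟨fun i => (eA i).1, fun j => (eG j).1, hAk, fun j => hFk _ (mG j).1.1, hAinj,
    Subtype.val_injective.comp eG.injective, fun i j (hij : (eA i).1 = (eG j).1) => (mA i).2 (by rw [hij]; exact (mG j).1.2),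
    fun i => (mA i).2, le_antisymm ?_ ?_, ?_, ?_, ?_⟩
  -- `manyFold` contains `Y` and obeys the same upper bound, so the two have equal size.
  · rw [← hthr]
    exact card_le_threshold (Fintype.card_fin _) hAk fun y hy => mem_manyFold_iff.1 hy
  · rw [← h.card_eq]
    exact Finset.card_le_card fun y hy => mem_manyFold_iff.2 (hY y hy)
  · intro j
    rw [hsm, Finset.mem_sdiff, Finset.mem_filter, star, Finset.mem_filter]
    exact ⟨⟨hF (mG j).1.1, (mG j).1.2⟩, fun hj => hj.2 (mG j).2⟩
  · rw [iA, iG]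
    intro P Q hP hQ
    have hsub : 𝒜 ∪ 𝒢 ⊆ F := Finset.union_subset (Finset.filter_subset _ _)
      ((Finset.filter_subset _ _).trans (Finset.filter_subset _ _))
    exact hUI P Q (hP.trans hsub) (hQ.trans hsub)
  · rw [hsm, iA, iG, ← hH]
    ext B
    simp only [h𝒜, h𝒢, Finset.mem_union, Finset.mem_filter]
    tauto

theorem card_description {n k s t β : ℕ} (hk : 1 ≤ k) (hs : 1 ≤ s) (ht : 1 ≤ t) {x : Fin n}
    {A : Fin (s + betaHat k s β) → Finset (Fin n)} {G : Fin (t - 1) → Finset (Fin n)}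
    (hA : ∀ i, (A i).card = k) (hAi : Function.Injective A) (hGi : Function.Injective G)
    (hx : ∀ i, x ∉ A i) (hT : (manyFold s (betaHat k s β) A).card = threshold k s β)
    (hG : ∀ j, G j ∈ star k x \ starMeeting k s (betaHat k s β) x A) :
    (starMeeting k s (betaHat k s β) x A ∪ Finset.univ.image A ∪ Finset.univ.image G).card =
      (n - 1).choose (k - 1) - (n - threshold k s β - 1).choose (k - 1) +
        (s + t + betaHat k s β - 1) := by
  -- All `s + betaHat k s β` of the `A i` miss `x`, which is not fewer than `s`.
  have hxT : x ∉ manyFold s (betaHat k s β) A := by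
    rw [mem_manyFold_iff, Finset.filter_true_of_mem fun i _ => hx i, Finset.card_univ,
      Fintype.card_fin]
    omega
  have hstar : ∀ B, B ∈ star k x → x ∈ B := fun B hB => (Finset.mem_filter.1 hB).2
  have hsub : starMeeting k s (betaHat k s β) x A ⊆ star k x := Finset.filter_subset _ _
  rw [Finset.card_union_of_disjoint, Finset.card_union_of_disjoint,
    Finset.card_image_of_injective _ hAi, Finset.card_image_of_injective _ hGi,
    Finset.card_univ, Finset.card_univ, Fintype.card_fin, Fintype.card_fin,
    starMeeting_eq x hs hA (fun y hy => mem_manyFold_iff.1 hy)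
      (by rw [hT, threshold_betaHat hs]), card_star_not_disjoint k hk hxT, hT]
  · omega
  · refine Finset.disjoint_left.2 fun B hB hBA => ?_
    obtain ⟨i, -, rfl⟩ := Finset.mem_image.1 hBA
    exact hx i (hstar _ (hsub hB))
  · refine Finset.disjoint_left.2 fun B hB hBG => ?_
    obtain ⟨j, -, rfl⟩ := Finset.mem_image.1 hBG
    obtain ⟨h1, h2⟩ := Finset.mem_sdiff.1 (hG j)
    rcases Finset.mem_union.1 hB with hB | hB
    · exact h2 hB
    · obtain ⟨i, -, hi⟩ := Finset.mem_image.1 hB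
      exact hx i (hi ▸ hstar _ h1)

end UnionIntersecting
/-- The ground set `[n]` is `Fin n`, and its element `0` plays the role of `1 ∈ [n]`. -/
theorem theorem1 (k s t β : ℕ) (hk : 3 ≤ k) (hs : 1 ≤ s) (hst : s ≤ t) :
    ∃ N : ℕ, ∀ (n : ℕ) [NeZero n], N ≤ n →
      ∀ F : Finset (Finset (Fin n)),
        F ⊆ (Finset.univ : Finset (Fin n)).powersetCard k →
        UnionIntersecting.IsUnionIntersecting s t F →
        s + β ≤ UnionIntersecting.ell F →
        F.card ≤ (n - 1).choose (k - 1)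
            - (n - UnionIntersecting.threshold k s β - 1).choose (k - 1)
            + (s + t + UnionIntersecting.betaHat k s β - 1) ∧
        (F.card = (n - 1).choose (k - 1)
            - (n - UnionIntersecting.threshold k s β - 1).choose (k - 1)
            + (s + t + UnionIntersecting.betaHat k s β - 1) ↔
          ∃ (A : Fin (s + UnionIntersecting.betaHat k s β) → Finset (Fin n))
            (G : Fin (t - 1) → Finset (Fin n)),
            (∀ i, (A i).card = k) ∧ (∀ j, (G j).card = k) ∧
            Function.Injective A ∧ Function.Injective G ∧ (∀ i j, A i ≠ G j) ∧
            (∀ i, (0 : Fin n) ∉ A i) ∧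
            (UnionIntersecting.manyFold s (UnionIntersecting.betaHat k s β) A).card
              = UnionIntersecting.threshold k s β ∧
            (∀ j, G j ∈ UnionIntersecting.star k (0 : Fin n) \
              UnionIntersecting.starMeeting k s (UnionIntersecting.betaHat k s β) 0 A) ∧
            UnionIntersecting.IsUnionIntersecting s t
              (Finset.univ.image A ∪ Finset.univ.image G) ∧
            UnionIntersecting.Isomorphic F
              (UnionIntersecting.starMeeting k s (UnionIntersecting.betaHat k s β) 0 A
                ∪ Finset.univ.image A ∪ Finset.univ.image G)) := by
  -- This is the bound of `pairs_count_lt` with `K` the size $M^k$ of the robust cover,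
  -- $M=(s+t+1)k$.
  refine ⟨UnionIntersecting.threshold k s β + k * (((s + t + 1) * k) ^ k +
    UnionIntersecting.threshold k s β * UnionIntersecting.threshold k s β) + 4,
    fun n _ hn F hF hUI hl => ?_⟩
  have hle : F.card ≤ (n - 1).choose (k - 1)
      - (n - UnionIntersecting.threshold k s β - 1).choose (k - 1)
      + (s + t + UnionIntersecting.betaHat k s β - 1) := by
    rcases le_total F.card ((n - 1).choose (k - 1)
      - (n - UnionIntersecting.threshold k s β - 1).choose (k - 1)) with h | h
    · exact Nat.le_add_right_of_le h
    · obtain ⟨x, Y, hxY⟩ := UnionIntersecting.exists_isCentered hk hs hn hF hUI hl h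
      exact hxY.card_le (by omega) hs hF hUI
  refine ⟨hle, fun hcard => ?_, ?_⟩
  · obtain ⟨x, Y, hxY⟩ := UnionIntersecting.exists_isCentered hk hs hn hF hUI hl
      (by rw [hcard]; exact Nat.le_add_right _ _)
    -- The transposition of `x` and `0` moves the centre to `0`.
    have hxY := hxY.image (Equiv.swap x 0)
    rw [Equiv.swap_apply_left] at hxY
    have hiso := UnionIntersecting.isomorphic_image F (Equiv.swap x 0)
    rw [hiso.card_eq] at hcard
    obtain ⟨A, G, h1, h2, h3, h4, h5, h6, h7, h8, h9, h10⟩ :=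
      hxY.exists_description (by omega) hs (by
        intro B hB
        obtain ⟨D, hD, rfl⟩ := Finset.mem_image.1 hB
        rw [Finset.mem_powersetCard, Finset.card_map]
        exact ⟨Finset.subset_univ _, (Finset.mem_powersetCard.1 (hF hD)).2⟩)
        (hUI.image _) hcard
    exact ⟨A, G, h1, h2, h3, h4, h5, h6, h7, h8, h9, h10 ▸ hiso⟩
  -- Isomorphism preserves cardinality, so the converse is a count of the described family.
  · rintro ⟨A, G, h1, -, h3, h4, -, h6, h7, h8, -, hiso⟩
    rw [hiso.card_eq]
    exact UnionIntersecting.card_description (by omega) hs (by omega) h1 h3 h4 h6 h7 h8
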